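/- Let $\kappa$ be an (infinite) regular cardinal. For a locally small category $\mathcal{C}$, let $\operatorname{Ind}_\kappa(\mathcal{C})$ be its $\kappa$-ind-completion, i.e. the full subcategory of the category of presheaves $\mathcal{C}^{\mathrm{op}}\to\mathbf{Sets}$ on those presheaves that are small $\kappa$-filtered colimits of representable presheaves. A functor $G:\mathcal{C}\to\mathcal{D}$ between locally small categories induces a functor $\operatorname{Ind}_\kappa(G):\operatorname{Ind}_\kappa(\mathcal{C})\to\operatorname{Ind}_\kappa(\mathcal{D})$, the essentially unique extension of $G$ that preserves small $\kappa$-filtered colimits (equivalently, the left Kan extension of $\mathcal{C}\to\mathcal{D}\to\operatorname{Ind}_\kappa(\mathcal{D})$ along $\mathcal{C}\to\operatorname{Ind}_\kappa(\mathcal{C})$). For a small category $K$, the functors $\operatorname{Ind}_\kappa(\mathrm{ev}_k):\operatorname{Ind}_\kappa(\mathcal{C}^K)\to\operatorname{Ind}_\kappa(\mathcal{C})$ induced by the evaluation functors $\mathrm{ev}_k:\mathcal{C}^K\to\mathcal{C}$, $k\in K$, together form the comparison functor \[ E^K_{\mathcal{C},\kappa}:\operatorname{Ind}_\kappa(\mathcal{C}^K)\to\operatorname{Ind}_\kappa(\mathcal{C})^K.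 \] For a category $I$ and an ordinal $\alpha$, regarded as the ordered set of the ordinals $\beta<\alpha$ (with a unique arrow $\beta\to\gamma$ if $\beta\le\gamma$), let $I^{(\alpha)}$ be the non-full subcategory of $I\times\alpha$ that has all the objects and whose morphisms are all the arrows $(x,\beta)\to(y,\gamma)$ of $I\times\alpha$ with $\beta<\gamma$, together with the identities. **Proposition.** Let $\mathcal{C}$ be any locally small category, let $I$ be a $\kappa$-small category (its set of arrows has cardinality $<\kappa$), and let $\alpha<\kappa$ be an ordinal. Then the comparison functor \[ E^{I^{(\alpha)}}_{\mathcal{C},\kappa}:\operatorname{Ind}_\kappa\bigl(\mathcal{C}^{I^{(\alpha)}}\bigr)\to\operatorname{Ind}_\kappa(\mathcal{C})^{I^{(\alpha)}} \] is an equivalence of categories. -/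

import Mathlib

open CategoryTheory CategoryTheory.Limits

universe w u v₁ u₁

noncomputable section

/-! ### The `κ`-ind-completion -/

namespace KappaInd

section Objects

variable (κ : Cardinal.{w}) [Fact κ.IsRegular]
variable (C : Type u) [Category.{w} C]

/-- The presheaves on a locally small category `C` which are colimits of representable presheaves
along a small `κ`-filtered category. -/
def isIndObject : ObjectProperty (Cᵒᵖ ⥤ Type w) := fun A =>
  ∃ (J : Type w) (_ : SmallCategory J) (_ : IsCardinalFiltered J κ)
    (F : J ⥤ C) (ι : F ⋙ yoneda ⟶ (Functor.const J).obj A),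
    Nonempty (IsColimit (Cocone.mk A ι))

/-- The `κ`-ind-completion `Ind_κ(C)`: the full subcategory of the category of presheaves on `C`
whose objects are the small `κ`-filtered colimits of representable presheaves. -/
abbrev Ind : Type (max u (w + 1)) := (isIndObject κ C).FullSubcategory

variable {C}

theorem isIndObject_yoneda (X : C) : isIndObject κ C (yoneda.obj X) := by
  refine ⟨Discrete PUnit.{w + 1}, inferInstance, ?_, Functor.fromPUnit X,
    { app := fun _ => 𝟙 _ }, ⟨{ desc := fun s => s.ι.app ⟨PUnit.unit⟩
                                uniq := fun _ _ h => by simpa using h ⟨PUnit.unit⟩ }⟩⟩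
  exact isCardinalFiltered_of_hasTerminal _ κ

variable (C)

/-- The embedding of `C` in `Ind_κ(C)`. -/
def yon : C ⥤ Ind κ C := (isIndObject κ C).lift yoneda (isIndObject_yoneda κ)

instance : (yon κ C).Full := inferInstanceAs ((isIndObject κ C).lift _ _).Full

instance : (yon κ C).Faithful := inferInstanceAs ((isIndObject κ C).lift _ _).Faithful

end Objects

section Functoriality

variable (κ : Cardinal.{w}) [Fact κ.IsRegular]
variable {C : Type u} [Category.{w} C] {D : Type u₁} [Category.{w} D]

/-- `Ind_κ(D)` has the colimits of small `κ`-filtered diagrams in `D`. -/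
theorem hasColimit_comp_yon {J : Type w} [SmallCategory J] [IsCardinalFiltered J κ]
    (F : J ⥤ D) : HasColimit (F ⋙ yon κ D) := by
  have hA : isIndObject κ D (colimit (F ⋙ yoneda)) :=
    ⟨J, inferInstance, inferInstance, F, (colimit.cocone (F ⋙ yoneda)).ι,
      ⟨colimit.isColimit (F ⋙ yoneda)⟩⟩
  let c : Cocone (F ⋙ yon κ D) :=
    { pt := ⟨_, hA⟩
      ι := { app := fun j => ObjectProperty.homMk (colimit.ι (F ⋙ yoneda) j)
             naturality := fun i j f => by
               ext1
               exact (colimit.cocone (F ⋙ yoneda)).ι.naturality f } }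
  have hc : IsColimit ((isIndObject κ D).ι.mapCocone c) := colimit.isColimit (F ⋙ yoneda)
  exact ⟨⟨c, isColimitOfReflects (isIndObject κ D).ι hc⟩⟩

instance hasPointwiseLeftKanExtension (G : C ⥤ D) :
    (yon κ C).HasPointwiseLeftKanExtension (G ⋙ yon κ D) := by
  intro X
  obtain ⟨J, _, _, F, ι, ⟨hι⟩⟩ := X.property
  let e : CostructuredArrow (yon κ C) X ≌ CostructuredArrow yoneda X.obj :=
    (CostructuredArrow.post (yon κ C) (isIndObject κ C).ι X).asEquivalence
  let T : J ⥤ CostructuredArrow yoneda X.obj :=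
    (Cocone.mk X.obj ι).toCostructuredArrow ⋙ CostructuredArrow.pre F yoneda X.obj
  have hT : T.Final := Presheaf.final_toCostructuredArrow_comp_pre F hι
  have : (T ⋙ e.inverse).Final := inferInstance
  have : HasColimit ((T ⋙ e.inverse) ⋙ CostructuredArrow.proj (yon κ C) X ⋙ G ⋙ yon κ D) :=
    hasColimit_comp_yon κ ((T ⋙ e.inverse) ⋙ CostructuredArrow.proj (yon κ C) X ⋙ G)
  exact Functor.Final.hasColimit_of_comp (T ⋙ e.inverse)

/-- The functor `Ind_κ(G) : Ind_κ(C) ⥤ Ind_κ(D)` induced by a functor `G : C ⥤ D`. It is the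
(pointwise) left Kan extension of `C ⥤ D ⥤ Ind_κ(D)` along `C ⥤ Ind_κ(C)`, that is, the
extension of `G` which preserves small `κ`-filtered colimits: it sends the formal colimit
of `F : J ⥤ C` to the formal colimit of `F ⋙ G`. -/
def indMap (G : C ⥤ D) : Ind κ C ⥤ Ind κ D :=
  (yon κ C).leftKanExtension (G ⋙ yon κ D)

/-- The canonical natural transformation (an isomorphism) expressing that `Ind_κ(G)` extends
`G`. -/
def indUnit (G : C ⥤ D) : G ⋙ yon κ D ⟶ yon κ C ⋙ indMap κ G :=
  (yon κ C).leftKanExtensionUnit (G ⋙ yon κ D)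

instance (G : C ⥤ D) : (indMap κ G).IsLeftKanExtension (indUnit κ G) :=
  inferInstanceAs (((yon κ C).leftKanExtension (G ⋙ yon κ D)).IsLeftKanExtension
    ((yon κ C).leftKanExtensionUnit (G ⋙ yon κ D)))

instance (G : C ⥤ D) : IsIso (indUnit κ G) :=
  (Functor.isPointwiseLeftKanExtensionOfIsLeftKanExtension _ (indUnit κ G)).isIso_hom

theorem indMap_hom_ext {G : C ⥤ D} {H : Ind κ C ⥤ Ind κ D} {φ ψ : indMap κ G ⟶ H}
    (h : ∀ X, φ.app ((yon κ C).obj X) = ψ.app ((yon κ C).obj X)) : φ = ψ :=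
  (indMap κ G).hom_ext_of_isLeftKanExtension (indUnit κ G) _ _ (by
    ext1; ext1 X; exact congrArg (_ ≫ ·) (h X))

/-- The natural transformation `Ind_κ(G) ⟶ Ind_κ(G')` induced by `η : G ⟶ G'`: the unique one
which extends `η`. -/
def indMap₂ {G G' : C ⥤ D} (η : G ⟶ G') : indMap κ G ⟶ indMap κ G' :=
  (indMap κ G).descOfIsLeftKanExtension (indUnit κ G) (indMap κ G')
    (Functor.whiskerRight η (yon κ D) ≫ indUnit κ G')

theorem indMap₂_app_yon {G G' : C ⥤ D} (η : G ⟶ G') (X : C) :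
    (indUnit κ G).app X ≫ (indMap₂ κ η).app ((yon κ C).obj X) =
      (yon κ D).map (η.app X) ≫ (indUnit κ G').app X :=
  (indMap κ G).descOfIsLeftKanExtension_fac_app (indUnit κ G) (indMap κ G')
    (Functor.whiskerRight η (yon κ D) ≫ indUnit κ G') X

variable (C D)

/-- The functor `G ↦ Ind_κ(G)`. -/
def indMapFunctor : (C ⥤ D) ⥤ (Ind κ C ⥤ Ind κ D) where
  obj G := indMap κ G
  map η := indMap₂ κ η
  map_id G := indMap_hom_ext κ fun X => by
    rw [← cancel_epi ((indUnit κ G).app X), indMap₂_app_yon]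
    simp
  map_comp η θ := indMap_hom_ext κ fun X => by
    rw [← cancel_epi ((indUnit κ _).app X), indMap₂_app_yon, NatTrans.comp_app, NatTrans.comp_app,
      Functor.map_comp, Category.assoc, ← indMap₂_app_yon, ← Category.assoc, ← indMap₂_app_yon,
      Category.assoc]

end Functoriality

/-- The comparison functor `E : Ind_κ(C^K) ⥤ Ind_κ(C)^K`, for a small category `K`. Its component
at an object `k` of `K` is the functor `Ind_κ(ev_k) : Ind_κ(C^K) ⥤ Ind_κ(C)` induced by the
evaluation functor `ev_k : C^K ⥤ C`. -/
def comparison (κ : Cardinal.{w}) [Fact κ.IsRegular] (C : Type u) [Category.{w} C]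
    (K : Type w) [SmallCategory K] : Ind κ (K ⥤ C) ⥤ (K ⥤ Ind κ C) :=
  (evaluation K C ⋙ indMapFunctor κ (K ⥤ C) C).flip

end KappaInd

/-! ### The category `I^(α)` -/

section OrdinalThickening

variable (I : Type u₁) [Category.{v₁} I] (α : Ordinal.{w})

/-- The morphisms `(x, β) ⟶ (y, γ)` of `I × α` which belong to `I^(α)`: all of them if `β < γ`,
and otherwise only the identities. Here the ordinal `α` is the ordered set of all ordinals `< α`,
with a unique arrow `β ⟶ γ` if `β ≤ γ`. -/
def strictOrId : MorphismProperty (I × α.ToType) := fun p q f =>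
  p.2 < q.2 ∨ ∃ h : p = q, f = eqToHom h

instance : (strictOrId I α).IsMultiplicative where
  id_mem p := Or.inr ⟨rfl, rfl⟩
  comp_mem {p q r} f g hf hg := by
    rcases hf with hf | ⟨rfl, rfl⟩
    · exact Or.inl (lt_of_lt_of_le hf (leOfHom g.2))
    · simpa using hg

/-- The category `I^(α)`: the non-full subcategory of `I × α` with all objects, and with
the morphisms which either strictly increase the ordinal or are identities. -/
abbrev OrdinalThickening : Type (max u₁ w) := WideSubcategory (strictOrId I α)

end OrdinalThickening

end

/-! For any `κ`-small `K` the comparison functor is fully faithful: a natural transformation from `F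
: K ⥤ C` to a pointwise `κ`-filtered colimit of functors `K ⥤ C` involves fewer than `κ` maps and
equations, so it is realised at one index, uniquely up to passing to a later one
(`exists_factor_whiskeringRight`, `exists_map_eq_whiskeringRight`).

Essential surjectivity uses a well-founded rank on `K` which every nonidentity arrow strictly
raises; on `I^(α)` this is the ordinal coordinate. Given `X : K ⥤ Ind_κ(C)`, present each `X.obj k`
by a `κ`-directed poset and consider the strict functors `K ⥤ C` over `X` built from terms of these
presentations (`Stage`). Recursion on the rank produces stages above fewer than `κ` given ones and
beyond prescribed indices (`Stage.exists_upper_bound`). Hence the stages are `κ`-directed and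
cofinal in each presentation, and `X` is the image of their formal colimit. -/

namespace KappaInd

/-! ### Formal `κ`-filtered colimits -/

section Colimits

variable {κ : Cardinal.{w}} [Fact κ.IsRegular]
variable {C : Type u} [Category.{w} C] {D : Type u₁} [Category.{w} D]
variable {J : Type w} [SmallCategory J] [IsCardinalFiltered J κ]

/-- The inclusion of `Ind_κ(C)` in the presheaves preserves the colimits of small `κ`-filtered
diagrams in `C`. -/
instance preservesColimit_comp_yon (F : J ⥤ C) :
    PreservesColimit (F ⋙ yon κ C) (isIndObject κ C).ι := by
  have hA : isIndObject κ C (colimit (F ⋙ yoneda)) :=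
    ⟨J, inferInstance, inferInstance, F, (colimit.cocone (F ⋙ yoneda)).ι,
      ⟨colimit.isColimit (F ⋙ yoneda)⟩⟩
  let c : Cocone (F ⋙ yon κ C) :=
    { pt := ⟨_, hA⟩
      ι := { app := fun j => ObjectProperty.homMk (colimit.ι (F ⋙ yoneda) j)
             naturality := fun i j f => by
               ext1
               exact (colimit.cocone (F ⋙ yoneda)).ι.naturality f } }
  have hc : IsColimit ((isIndObject κ C).ι.mapCocone c) := colimit.isColimit (F ⋙ yoneda)
  exact preservesColimit_of_preserves_colimit_cocone
    (isColimitOfReflects (isIndObject κ C).ι hc) hc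

/-- Maps from an object of `C` to a formal `κ`-filtered colimit, as a colimit of types. -/
noncomputable def isColimitHomYon {F : J ⥤ C} {c : Cocone (F ⋙ yon κ C)} (hc : IsColimit c) (X : C) :
    IsColimit (((evaluation Cᵒᵖ (Type w)).obj (Opposite.op X)).mapCocone
      ((isIndObject κ C).ι.mapCocone c)) :=
  isColimitOfPreserves _ (isColimitOfPreserves _ hc)

theorem yonedaEquiv_yon_map_comp {X Y : C} (g : X ⟶ Y) {A : Ind κ C} (f : (yon κ C).obj Y ⟶ A) :
    yonedaEquiv ((yon κ C).map g ≫ f).hom = f.hom.app (Opposite.op X) g := by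
  change f.hom.app (Opposite.op X) (𝟙 X ≫ g) = _
  rw [Category.id_comp]

/-- By Yoneda, `f` is an element of the presheaf `c.pt` at `X`, and that presheaf is a colimit
computed in types. -/
theorem exists_factor {F : J ⥤ C} {c : Cocone (F ⋙ yon κ C)} (hc : IsColimit c) {X : C}
    (f : (yon κ C).obj X ⟶ c.pt) : ∃ (j : J) (g : X ⟶ F.obj j), (yon κ C).map g ≫ c.ι.app j = f := by
  obtain ⟨j, g, hg⟩ := Types.jointly_surjective_of_isColimit (isColimitHomYon hc X)
    (yonedaEquiv f.hom)
  refine ⟨j, g, ?_⟩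
  ext1
  apply yonedaEquiv.injective
  exact (yonedaEquiv_yon_map_comp g _).trans hg

theorem exists_map_eq {F : J ⥤ C} {c : Cocone (F ⋙ yon κ C)} (hc : IsColimit c) {X : C} {j : J}
    (g g' : X ⟶ F.obj j)
    (h : (yon κ C).map g ≫ c.ι.app j = (yon κ C).map g' ≫ c.ι.app j) :
    ∃ (j' : J) (a : j ⟶ j'), g ≫ F.map a = g' ≫ F.map a := by
  have := isFiltered_of_isCardinalFiltered J κ
  refine (Types.FilteredColimit.isColimit_eq_iff' (isColimitHomYon hc X) g g').1 ?_
  exact (yonedaEquiv_yon_map_comp g _).symm.trans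
    ((congrArg (fun φ => yonedaEquiv φ.hom) h).trans (yonedaEquiv_yon_map_comp g' _))

variable (κ) in
/-- Every object of `Ind_κ(C)` is the colimit of a diagram in `C` indexed by a `κ`-directed
poset. -/
theorem exists_directed_presentation (A : Ind κ C) :
    ∃ (J : Type w) (_ : PartialOrder J) (_ : IsCardinalFiltered J κ) (F : J ⥤ C)
      (ι : F ⋙ yon κ C ⟶ (Functor.const J).obj A), Nonempty (IsColimit (Cocone.mk A ι)) := by
  obtain ⟨J₀, _, _, F, ι, ⟨hι⟩⟩ := A.property
  obtain ⟨J, _, _, T, _⟩ := IsCardinalFiltered.exists_cardinal_directed J₀ κ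
  let ι' : F ⋙ yon κ C ⟶ (Functor.const J₀).obj A :=
    { app := fun j => ObjectProperty.homMk (ι.app j)
      naturality := fun i j f => by
        ext1
        exact ι.naturality f }
  have h : IsColimit ((isIndObject κ C).ι.mapCocone (Cocone.mk A ι')) := hι
  exact ⟨J, inferInstance, inferInstance, T ⋙ F, Functor.whiskerLeft T ι',
    ⟨(Functor.Final.isColimitWhiskerEquiv T (Cocone.mk A ι')).symm
      (isColimitOfReflects (isIndObject κ C).ι h)⟩⟩

/-- Finality is known over presheaves, and passes to `Ind_κ(C)` because the latter is a full
subcategory. It reduces the pointwise Kan extension formula for `indMap` at `c.pt` to a colimit over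
`J`. -/
theorem final_toCostructuredArrow_yon {F : J ⥤ C} {c : Cocone (F ⋙ yon κ C)} (hc : IsColimit c) :
    (c.toCostructuredArrow ⋙ CostructuredArrow.pre F (yon κ C) c.pt).Final := by
  let e : CostructuredArrow (yon κ C) c.pt ≌ CostructuredArrow yoneda c.pt.obj :=
    (CostructuredArrow.post (yon κ C) (isIndObject κ C).ι c.pt).asEquivalence
  have hc' := isColimitOfPreserves (isIndObject κ C).ι hc
  have hT := Presheaf.final_toCostructuredArrow_comp_pre (F := F)
    (c := Cocone.mk c.pt.obj ((isIndObject κ C).ι.mapCocone c).ι) hc'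
  have : ((c.toCostructuredArrow ⋙ CostructuredArrow.pre F (yon κ C) c.pt) ⋙ e.functor).Final :=
    hT
  exact Functor.final_of_comp_full_faithful
    (c.toCostructuredArrow ⋙ CostructuredArrow.pre F (yon κ C) c.pt) e.functor

/-- `Ind_κ(G)` preserves the colimits of small `κ`-filtered diagrams in `C`. -/
instance preservesColimit_indMap (G : C ⥤ D) (F : J ⥤ C) :
    PreservesColimit (F ⋙ yon κ C) (indMap κ G) where
  preserves {c} hc := by
    have := final_toCostructuredArrow_yon hc
    have h := Functor.isPointwiseLeftKanExtensionOfIsLeftKanExtension _ (indUnit κ G) c.pt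
    have h' := (Functor.Final.isColimitWhiskerEquiv
      (c.toCostructuredArrow ⋙ CostructuredArrow.pre F (yon κ C) c.pt) _).symm h
    refine ⟨(IsColimit.precomposeHomEquiv (Functor.isoWhiskerLeft F (asIso (indUnit κ G))) _) ?_⟩
    exact IsColimit.ofIsoColimit h' (Cocone.ext (Iso.refl _) fun j => Category.comp_id _)

end Colimits

end KappaInd

namespace KappaInd

/-! ### Eventual properties in `κ`-directed posets -/

section Directed

open Filter

variable {κ : Cardinal.{w}} [Fact κ.IsRegular] {J : Type w} [Preorder J] [IsCardinalFiltered J κ]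

variable (κ J) in
include κ in
theorem neBot_atTop_of_isCardinalFiltered : (atTop : Filter J).NeBot := by
  have := isFiltered_of_isCardinalFiltered J κ
  have : Nonempty J := IsFiltered.nonempty
  have : IsDirectedOrder J := IsFiltered.isDirectedOrder J
  infer_instance

theorem exists_forall_le {ι : Type*} (hι : HasCardinalLT ι κ) (s : ι → J) :
    ∃ j, ∀ i, s i ≤ j :=
  ⟨IsCardinalFiltered.max s hι, fun i => leOfHom (IsCardinalFiltered.toMax s hι i)⟩

/-- Fewer than `κ` thresholds have a common upper bound. This lets all the conditions in later
constructions be met at once. -/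
theorem eventually_atTop_forall {ι : Type*} (hι : HasCardinalLT ι κ) {p : ι → J → Prop}
    (h : ∀ i, ∀ᶠ j in atTop, p i j) : ∀ᶠ j in atTop, ∀ i, p i j := by
  have := isFiltered_of_isCardinalFiltered J κ
  have : Nonempty J := IsFiltered.nonempty
  have : IsDirectedOrder J := IsFiltered.isDirectedOrder J
  simp only [eventually_atTop] at h
  choose s hs using h
  obtain ⟨j₀, hj₀⟩ := exists_forall_le hι s
  filter_upwards [eventually_ge_atTop j₀] with j hj i
  exact hs i j ((hj₀ i).trans hj)

theorem eventually_map_eq {C : Type u} [Category.{w} C] {F : J ⥤ C} {c : Cocone (F ⋙ yon κ C)}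
    (hc : IsColimit c) {X : C} {j j' : J} (g : X ⟶ F.obj j) (g' : X ⟶ F.obj j')
    (h : (yon κ C).map g ≫ c.ι.app j = (yon κ C).map g' ≫ c.ι.app j') :
    ∀ᶠ l in atTop, ∀ (hl : j ≤ l) (hl' : j' ≤ l),
      g ≫ F.map (homOfLE hl) = g' ≫ F.map (homOfLE hl') := by
  have := isFiltered_of_isCardinalFiltered J κ
  obtain ⟨i, a, a', -⟩ := IsFilteredOrEmpty.cocone_objs j j'
  obtain ⟨i', b, hb⟩ := exists_map_eq hc (g ≫ F.map a) (g' ≫ F.map a') (by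
    have ha := c.w a
    have ha' := c.w a'
    dsimp at ha ha'
    rw [Functor.map_comp, Functor.map_comp, Category.assoc, Category.assoc, ha, ha', h])
  filter_upwards [eventually_ge_atTop i'] with l hl h₁ h₂
  rw [show homOfLE h₁ = a ≫ b ≫ homOfLE hl from rfl,
    show homOfLE h₂ = a' ≫ b ≫ homOfLE hl from rfl]
  simp only [Category.assoc] at hb
  simp only [F.map_comp, reassoc_of% hb]

end Directed

/-! ### Full faithfulness for `κ`-small `K` -/

section FullyFaithful

open Filter

variable {κ : Cardinal.{w}} [Fact κ.IsRegular]
variable {C : Type u} [Category.{w} C]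
variable {K : Type w} [SmallCategory K]

section

variable {J : Type w} [PartialOrder J] [IsCardinalFiltered J κ] {G : J ⥤ K ⥤ C}
  {d : Cocone (G ⋙ (Functor.whiskeringRight K C (Ind κ C)).obj (yon κ C))}

theorem exists_factor_whiskeringRight (hK : HasCardinalLT (Arrow K) κ)
    (hd : ∀ k, IsColimit (((evaluation K (Ind κ C)).obj k).mapCocone d)) {F : K ⥤ C}
    (φ : F ⋙ yon κ C ⟶ d.pt) :
    ∃ (j : J) (g : F ⟶ G.obj j), Functor.whiskerRight g (yon κ C) ≫ d.ι.app j = φ := by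
  choose s g hg using fun k =>
    exists_factor (F := G ⋙ (evaluation K C).obj k) (hd k) (φ.app k)
  obtain ⟨j, hj⟩ := exists_forall_le (hasCardinalLT_of_hasCardinalLT_arrow hK) s
  let g' (k : K) : F.obj k ⟶ (G.obj j).obj k := g k ≫ (G.map (homOfLE (hj k))).app k
  have hg' (k : K) : (yon κ C).map (g' k) ≫ (d.ι.app j).app k = φ.app k := by
    rw [← hg k, Functor.map_comp, Category.assoc]
    congr 1
    exact NatTrans.congr_app (d.w (homOfLE (hj k))) k
  -- The components at `j` are natural only after mapping to `d.pt`; hence each naturality square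
  -- commutes from some index on.
  have hnat (u : Arrow K) := eventually_map_eq (F := G ⋙ (evaluation K C).obj u.right) (hd u.right)
    (j := j) (F.map u.hom ≫ g' u.right) (g' u.left ≫ (G.obj j).map u.hom) (by
      have h₁ := φ.naturality u.hom
      have h₂ := (d.ι.app j).naturality u.hom
      rw [← hg', ← hg', Category.assoc] at h₁
      rw [Functor.map_comp _ (F.map _), Functor.map_comp _ (g' _), Category.assoc, Category.assoc]
      exact h₁.trans (congrArg (_ ≫ ·) h₂.symm))
  have := neBot_atTop_of_isCardinalFiltered κ J
  obtain ⟨l, hl, hjl⟩ := ((eventually_atTop_forall hK hnat).and (eventually_ge_atTop j)).exists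
  refine ⟨l, { app := fun k => g' k ≫ (G.map (homOfLE hjl)).app k
               naturality := fun k k' u => ?_ }, ?_⟩
  · have := hl (Arrow.mk u) hjl hjl
    dsimp at this
    rw [Category.assoc] at this
    simp [this]
  · ext1
    ext1 k
    rw [← hg' k]
    have := NatTrans.congr_app (d.w (homOfLE hjl)) k
    dsimp at this ⊢
    rw [Functor.map_comp, Category.assoc, this]

theorem exists_map_eq_whiskeringRight (hK : HasCardinalLT (Arrow K) κ)
    (hd : ∀ k, IsColimit (((evaluation K (Ind κ C)).obj k).mapCocone d)) {F : K ⥤ C} {j : J}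
    (g g' : F ⟶ G.obj j)
    (h : Functor.whiskerRight g (yon κ C) ≫ d.ι.app j =
      Functor.whiskerRight g' (yon κ C) ≫ d.ι.app j) :
    ∃ (j' : J) (a : j ⟶ j'), g ≫ G.map a = g' ≫ G.map a := by
  have := neBot_atTop_of_isCardinalFiltered κ J
  have hev (k : K) := eventually_map_eq (F := G ⋙ (evaluation K C).obj k) (hd k)
    (j := j) (g.app k) (g'.app k) (NatTrans.congr_app h k)
  obtain ⟨l, hl, hjl⟩ := ((eventually_atTop_forall (hasCardinalLT_of_hasCardinalLT_arrow hK)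
    hev).and (eventually_ge_atTop j)).exists
  refine ⟨l, homOfLE hjl, ?_⟩
  ext k
  exact hl k hjl hjl

end

variable (κ C K) in
/-- The comparison functor sends a functor `K ⥤ C` to its composition with `C ⥤ Ind_κ(C)`. -/
noncomputable def whiskeringRightYonIso :
    (Functor.whiskeringRight K C (Ind κ C)).obj (yon κ C) ≅ yon κ (K ⥤ C) ⋙ comparison κ C K :=
  NatIso.ofComponents
    (fun F => NatIso.ofComponents
      (fun k => (asIso (indUnit κ ((evaluation K C).obj k))).app F)
      (fun {k k'} u => (indMap₂_app_yon κ ((evaluation K C).map u) F).symm))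
    (fun {F G} η => by
      ext1
      ext1 k
      exact (indUnit κ ((evaluation K C).obj k)).naturality η)

instance preservesColimit_comparison {J : Type w} [SmallCategory J] [IsCardinalFiltered J κ]
    (G : J ⥤ K ⥤ C) : PreservesColimit (G ⋙ yon κ (K ⥤ C)) (comparison κ C K) where
  preserves {_} hc := ⟨evaluationJointlyReflectsColimits _ fun k =>
    isColimitOfPreserves (indMap κ ((evaluation K C).obj k)) hc⟩

/-- The image under the comparison functor of a cocone over a diagram in `K ⥤ C`. -/
noncomputable def comparisonCocone {J : Type w} [SmallCategory J] {G : J ⥤ K ⥤ C}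
    (c : Cocone (G ⋙ yon κ (K ⥤ C))) :
    Cocone (G ⋙ (Functor.whiskeringRight K C (Ind κ C)).obj (yon κ C)) :=
  (Cocone.precompose (Functor.whiskerLeft G (whiskeringRightYonIso κ C K).hom)).obj
    ((comparison κ C K).mapCocone c)

/-- The comparison functor preserves small `κ`-filtered colimits of functors `K ⥤ C`. -/
noncomputable def isColimitComparisonCocone {J : Type w} [SmallCategory J]
    [IsCardinalFiltered J κ] {G : J ⥤ K ⥤ C}
    {c : Cocone (G ⋙ yon κ (K ⥤ C))} (hc : IsColimit c) : IsColimit (comparisonCocone c) :=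
  (IsColimit.precomposeHomEquiv (Functor.isoWhiskerLeft G (whiskeringRightYonIso κ C K)) _).symm
    (isColimitOfPreserves (comparison κ C K) hc)

/-- The comparison functor preserves small `κ`-filtered colimits of functors `K ⥤ C` pointwise. -/
noncomputable def isColimitComparisonCoconeApp {J : Type w} [SmallCategory J]
    [IsCardinalFiltered J κ] {G : J ⥤ K ⥤ C}
    {c : Cocone (G ⋙ yon κ (K ⥤ C))} (hc : IsColimit c) (k : K) :
    IsColimit (((evaluation K (Ind κ C)).obj k).mapCocone (comparisonCocone c)) :=
  (IsColimit.precomposeHomEquiv (Functor.isoWhiskerLeft G (Functor.isoWhiskerRight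
    (whiskeringRightYonIso κ C K) ((evaluation K (Ind κ C)).obj k))) _).symm
    (isColimitOfPreserves (indMap κ ((evaluation K C).obj k)) hc)

theorem whiskerRight_comp_comparisonCocone_ι {J : Type w} [SmallCategory J] {G : J ⥤ K ⥤ C}
    (c : Cocone (G ⋙ yon κ (K ⥤ C))) {F : K ⥤ C} {j : J} (g : F ⟶ G.obj j) :
    Functor.whiskerRight g (yon κ C) ≫ (comparisonCocone c).ι.app j =
      (whiskeringRightYonIso κ C K).hom.app F ≫
        (comparison κ C K).map ((yon κ (K ⥤ C)).map g ≫ c.ι.app j) := by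
  have := (whiskeringRightYonIso κ C K).hom.naturality_assoc g
    ((comparison κ C K).map (c.ι.app j))
  rw [Functor.map_comp]
  exact this

theorem comparison_faithful (hK : HasCardinalLT (Arrow K) κ) : (comparison κ C K).Faithful where
  map_injective {A B} f f' h := by
    obtain ⟨I, _, _, F, ι, ⟨hι⟩⟩ := exists_directed_presentation κ A
    obtain ⟨J, _, _, G, ι', ⟨hι'⟩⟩ := exists_directed_presentation κ B
    refine hι.hom_ext fun i => ?_
    obtain ⟨j, g, hg⟩ := exists_factor hι' (ι.app i ≫ f)
    obtain ⟨j', g', hg'⟩ := exists_factor hι' (ι.app i ≫ f')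
    have := isFiltered_of_isCardinalFiltered J κ
    obtain ⟨l, a, a', -⟩ := IsFilteredOrEmpty.cocone_objs j j'
    have ha := (Cocone.mk B ι').w a
    have ha' := (Cocone.mk B ι').w a'
    rw [← ha] at hg
    rw [← ha'] at hg'
    dsimp at hg hg' ⊢
    rw [← Functor.map_comp_assoc] at hg hg'
    obtain ⟨m, b, hb⟩ := exists_map_eq_whiskeringRight hK (isColimitComparisonCoconeApp hι')
      (g ≫ G.map a) (g' ≫ G.map a') (by
        rw [whiskerRight_comp_comparisonCocone_ι, whiskerRight_comp_comparisonCocone_ι, hg, hg',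
          Functor.map_comp, Functor.map_comp, h])
    have hb' := (Cocone.mk B ι').w b
    dsimp at hb'
    rw [← hg, ← hg', ← hb', ← Functor.map_comp_assoc, ← Functor.map_comp_assoc, hb]

/-- The map is lifted on each term of a presentation of `A`; faithfulness makes the lifts
compatible, so they glue. -/
theorem comparison_full (hK : HasCardinalLT (Arrow K) κ) : (comparison κ C K).Full where
  map_surjective {A B} φ := by
    have := comparison_faithful (κ := κ) (C := C) hK
    obtain ⟨I, _, _, F, ι, ⟨hι⟩⟩ := exists_directed_presentation κ A
    obtain ⟨J, _, _, G, ι', ⟨hι'⟩⟩ := exists_directed_presentation κ B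
    have hex (i : I) : ∃ f : (yon κ (K ⥤ C)).obj (F.obj i) ⟶ B,
        (comparison κ C K).map f = (comparison κ C K).map (ι.app i) ≫ φ := by
      obtain ⟨j, g, hg⟩ := exists_factor_whiskeringRight hK (isColimitComparisonCoconeApp hι')
        ((whiskeringRightYonIso κ C K).hom.app (F.obj i) ≫
          (comparison κ C K).map (ι.app i) ≫ φ)
      rw [whiskerRight_comp_comparisonCocone_ι] at hg
      exact ⟨_, (cancel_epi ((whiskeringRightYonIso κ C K).hom.app (F.obj i))).1 hg⟩
    choose f hf using hex
    let s : Cocone (F ⋙ yon κ (K ⥤ C)) :=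
      { pt := B
        ι := { app := f
               naturality := fun i i' a => (comparison κ C K).map_injective (by
                have := (Cocone.mk A ι).w a
                dsimp at this ⊢
                rw [Category.comp_id, Functor.map_comp, hf, hf, ← Functor.map_comp_assoc, this]) } }
    refine ⟨hι.desc s, (isColimitOfPreserves (comparison κ C K) hι).hom_ext fun i => ?_⟩
    have := hι.fac s i
    dsimp at this ⊢
    rw [← Functor.map_comp, this]
    exact hf i

end FullyFaithful

end KappaInd

namespace KappaInd

/-! ### Essential surjectivity through stages -/

open Filter

/-- The condition `p` sees the values chosen at smaller rank, but not the conditions that those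
values satisfy. -/
theorem exists_wellFounded_choice {K : Type*} {W : Type*} [Preorder W] [WellFoundedLT W]
    (r : K → W) {J : K → Type*} (p : ∀ k, (∀ k', r k' < r k → J k') → J k → Prop)
    (h : ∀ k q, ∃ j, p k q j) : ∃ f : ∀ k, J k, ∀ k, p k (fun k' _ => f k') (f k) := by
  choose b hb using h
  have hwf : WellFounded (fun k' k => r k' < r k) := InvImage.wf r wellFounded_lt
  refine ⟨hwf.fix b, fun k => ?_⟩
  have := hb k (fun k' _ => hwf.fix b k')
  rwa [← hwf.fix_eq b] at this

variable {κ : Cardinal.{w}} [Fact κ.IsRegular]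
variable {C : Type u} [Category.{w} C]
variable {K : Type w} [SmallCategory K] {X : K ⥤ Ind κ C}
variable {J : K → Type w} [∀ k, PartialOrder (J k)] {c : ∀ k, J k ⥤ C}

/-- Given a diagram `X : K ⥤ Ind_κ(C)` and presentations of its values as formal colimits,
a functor `K ⥤ C` over `X` whose values are taken from these presentations. -/
structure Stage (ι : ∀ k, c k ⋙ yon κ C ⟶ (Functor.const (J k)).obj (X.obj k)) : Type w where
  /-- The position in each of the presentations. -/
  idx (k : K) : J k
  /-- The action on morphisms. -/
  map {k k' : K} (u : k ⟶ k') : (c k).obj (idx k) ⟶ (c k').obj (idx k')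
  map_id (k : K) : map (𝟙 k) = 𝟙 _
  map_comp {k k' k'' : K} (u : k ⟶ k') (v : k' ⟶ k'') : map (u ≫ v) = map u ≫ map v
  w {k k' : K} (u : k ⟶ k') :
    (yon κ C).map (map u) ≫ (ι k').app (idx k') = (ι k).app (idx k) ≫ X.map u

namespace Stage

variable {ι : ∀ k, c k ⋙ yon κ C ⟶ (Functor.const (J k)).obj (X.obj k)}

/-- The order asks that the transition maps of the presentations form a natural transformation
between the underlying functors. -/
instance : Preorder (Stage ι) where
  le p q := ∃ h : ∀ k, p.idx k ≤ q.idx k, ∀ ⦃k k' : K⦄ (u : k ⟶ k'),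
    p.map u ≫ (c k').map (homOfLE (h k')) = (c k).map (homOfLE (h k)) ≫ q.map u
  le_refl p := ⟨fun _ => le_rfl, fun k k' u => by simp⟩
  le_trans p q r := fun ⟨h, hpq⟩ ⟨h', hqr⟩ => ⟨fun k => (h k).trans (h' k), fun k k' u => by
    rw [← homOfLE_comp (h k') (h' k'), ← homOfLE_comp (h k) (h' k), Functor.map_comp,
      Functor.map_comp, Category.assoc, ← hqr, reassoc_of% (hpq u)]⟩

/-- The functor `K ⥤ C` underlying a stage. -/
@[simps]
def toFunctor (p : Stage ι) : K ⥤ C where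
  obj k := (c k).obj (p.idx k)
  map u := p.map u
  map_id := p.map_id
  map_comp := p.map_comp

variable (ι) in
/-- The position in the presentation of `X.obj k`. -/
def idxFunctor (k : K) : Stage ι ⥤ J k :=
  Monotone.functor (f := fun p : Stage ι => p.idx k) fun _ _ h => h.1 k

variable (ι) in
/-- The diagram of all stages. -/
@[simps]
def diagram : Stage ι ⥤ K ⥤ C where
  obj p := p.toFunctor
  map {p q} h :=
    { app := fun k => (c k).map ((idxFunctor ι k).map h)
      naturality := fun _ _ u => (leOfHom h).2 u }
  map_id p := by ext k; exact (c k).map_id _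
  map_comp f g := by ext k; exact (c k).map_comp _ _

variable (ι) in
/-- The diagram of all stages, as a diagram over `X`. -/
@[simps]
def cocone : Cocone (diagram ι ⋙ (Functor.whiskeringRight K C (Ind κ C)).obj (yon κ C)) where
  pt := X
  ι :=
    { app := fun p =>
        { app := fun k => (ι k).app (p.idx k)
          naturality := fun _ _ u => p.w u }
      naturality := fun p q h => by
        ext1
        ext1 k
        exact (ι k).naturality ((idxFunctor ι k).map h) }

section

variable [∀ k, IsCardinalFiltered (J k) κ] {W : Type*} [Preorder W] [WellFoundedLT W]

theorem exists_upper_bound (hι : ∀ k, IsColimit (Cocone.mk (X.obj k) (ι k)))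
    (hK : HasCardinalLT (Arrow K) κ) (r : K → W)
    (hr : ∀ ⦃k k' : K⦄ (u : k ⟶ k'), r k < r k' ∨ ∃ h : k = k', u = eqToHom h)
    {A : Type*} (hA : HasCardinalLT A κ) (p : A → Stage ι) (s : ∀ k, J k) :
    ∃ q : Stage ι, (∀ a, p a ≤ q) ∧ ∀ k, s k ≤ q.idx k := by
  have hK₀ : HasCardinalLT K κ := hasCardinalLT_of_hasCardinalLT_arrow hK
  have hK₁ (k k' : K) : HasCardinalLT (k ⟶ k') κ :=
    hK.of_injective (fun u => Arrow.mk u) fun u v h => by cases h; rfl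
  classical
  -- `t k k' u j` lifts `X.map u` on the `j`-th term over `k` to the term of index `m k k' u j` over
  -- `k'`.
  choose m t ht using fun (k k' : K) (u : k ⟶ k') (j : J k) =>
    exists_factor (hι k') ((ι k).app j ≫ X.map u)
  dsimp at ht
  have hw (k : K) {i j : J k} (h : i ≤ j) :
      (yon κ C).map ((c k).map (homOfLE h)) ≫ (ι k).app j = (ι k).app i :=
    (Cocone.mk _ (ι k)).w (homOfLE h)
  -- The index at `k` lies beyond `s k`, all `(p a).idx k` and all targets of lifts from lower rank,
  -- and is late enough for the lifts to compose strictly and to be compatible with each `p a`. The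
  -- bounds `hm` and `hq` at lower rank enter as hypotheses, being unavailable during the recursion;
  -- `hm` and `hp` discharge them afterwards.
  obtain ⟨f, hf⟩ := exists_wellFounded_choice r (J := J) (fun k q j =>
      s k ≤ j ∧ (∀ a, (p a).idx k ≤ j) ∧
      (∀ k' (u : k' ⟶ k) (h : r k' < r k), m k' k u (q k' h) ≤ j) ∧
      (∀ k' (u : k' ⟶ k) (h : r k' < r k) k'' (v : k'' ⟶ k') (h' : r k'' < r k')
        (hm : m k'' k' v (q k'' (h'.trans h)) ≤ q k' h)
        (n : m k'' k (v ≫ u) (q k'' (h'.trans h)) ≤ j) (n' : m k' k u (q k' h) ≤ j),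
        t k'' k (v ≫ u) _ ≫ (c k).map (homOfLE n) =
          (t k'' k' v _ ≫ (c k').map (homOfLE hm) ≫ t k' k u _) ≫ (c k).map (homOfLE n')) ∧
      (∀ a k' (u : k' ⟶ k) (h : r k' < r k) (hq : (p a).idx k' ≤ q k' h)
        (n : (p a).idx k ≤ j) (n' : m k' k u (q k' h) ≤ j),
        (p a).map u ≫ (c k).map (homOfLE n) =
          ((c k').map (homOfLE hq) ≫ t k' k u _) ≫ (c k).map (homOfLE n')))
    (fun k q => by
      have := neBot_atTop_of_isCardinalFiltered κ (J k)
      refine ((eventually_ge_atTop _).and ((eventually_atTop_forall hA fun a =>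
        eventually_ge_atTop _).and ((eventually_atTop_forall hK₀ fun k' =>
        eventually_atTop_forall (hK₁ _ _) fun u => eventually_all.2 fun h =>
        eventually_ge_atTop _).and (Eventually.and ?_ ?_)))).exists
      · refine eventually_atTop_forall hK₀ fun k' => eventually_atTop_forall (hK₁ _ _) fun u =>
          eventually_all.2 fun h => eventually_atTop_forall hK₀ fun k'' =>
          eventually_atTop_forall (hK₁ _ _) fun v => eventually_all.2 fun h' =>
          eventually_all.2 fun hm => eventually_map_eq (hι k) _ _ ?_
        simp only [Functor.map_comp, Category.assoc, ht, reassoc_of% (hw k' hm), reassoc_of% ht]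
      · refine eventually_atTop_forall hA fun a =>
          eventually_atTop_forall hK₀ fun k' => eventually_atTop_forall (hK₁ _ _) fun u =>
          eventually_all.2 fun h => eventually_all.2 fun hq =>
          eventually_map_eq (hι k) _ _ ?_
        simp only [Functor.map_comp, Category.assoc, ht, reassoc_of% (hw k' hq)]
        exact (p a).w u)
  choose hs hp hm hcomp hpm using hf
  -- An arrow that does not raise the rank is an identity, so no lift has to be chosen for it.
  let map {k k' : K} (u : k ⟶ k') : (c k).obj (f k) ⟶ (c k').obj (f k') :=
    if h : r k < r k' then t k k' u (f k) ≫ (c k').map (homOfLE (hm k' k u h))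
    else eqToHom (by obtain ⟨rfl, _⟩ := (hr u).resolve_left h; rfl)
  have map_lt {k k' : K} (u : k ⟶ k') (h : r k < r k') :
      map u = t k k' u (f k) ≫ (c k').map (homOfLE (hm k' k u h)) := dif_pos h
  have map_id (k : K) : map (𝟙 k) = 𝟙 _ := dif_neg (lt_irrefl _)
  let q : Stage ι :=
    { idx := f
      map := map
      map_id := map_id
      map_comp := fun {k k' k''} v u => by
        rcases hr v with hv | ⟨rfl, rfl⟩
        · rcases hr u with hu | ⟨rfl, rfl⟩
          · rw [map_lt v hv, map_lt u hu, map_lt (v ≫ u) (hv.trans hu),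
              hcomp k'' k' u hu k v hv (hm k' k v hv) _ (hm k'' k' u hu)]
            simp only [Category.assoc]
          · simp [map_id]
        · simp [map_id]
      w := fun {k k'} u => by
        rcases hr u with hu | ⟨rfl, rfl⟩
        · rw [map_lt u hu, Functor.map_comp, Category.assoc, hw, ht]
        · simp [map_id] }
  refine ⟨q, fun a => ⟨fun k => hp k a, fun k k' u => ?_⟩, hs⟩
  change _ = _ ≫ map u
  rcases hr u with hu | ⟨rfl, rfl⟩
  · rw [map_lt u hu, hpm k' a k u hu (hp k a) _ (hm k' k u hu), Category.assoc]
  · simp [map_id, Stage.map_id]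

variable (hι : ∀ k, IsColimit (Cocone.mk (X.obj k) (ι k)))
  (hK : HasCardinalLT (Arrow K) κ) (r : K → W)
  (hr : ∀ ⦃k k' : K⦄ (u : k ⟶ k'), r k < r k' ∨ ∃ h : k = k', u = eqToHom h)

include hι hK hr

theorem isCardinalFiltered : IsCardinalFiltered (Stage ι) κ :=
  isCardinalFiltered_preorder _ _ fun A p hA => by
    have (k : K) : Nonempty (J k) := IsCardinalFiltered.nonempty (J k) κ
    obtain ⟨q, hq, -⟩ := exists_upper_bound hι hK r hr
      ((hasCardinalLT_iff_cardinal_mk_lt A κ).2 hA) p fun _ => Classical.arbitrary _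
    exact ⟨q, hq⟩

theorem final_idxFunctor (k : K) : (idxFunctor ι k).Final := by
  have := isCardinalFiltered hι hK r hr
  have := isFiltered_of_isCardinalFiltered (Stage ι) κ
  have := IsFiltered.isDirectedOrder (Stage ι)
  refine (Monotone.final_functor_iff _).2 fun j => ?_
  classical
  have (k : K) : Nonempty (J k) := IsCardinalFiltered.nonempty (J k) κ
  obtain ⟨q, -, hq⟩ := exists_upper_bound hι hK r hr
    (hasCardinalLT_of_finite PEmpty.{w + 1} κ (Cardinal.IsRegular.aleph0_le Fact.out))
    -- Only cofinality at `k` is needed: an empty family of stages, with `j` prescribed at `k` and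
    -- arbitrary indices elsewhere.
    PEmpty.elim (Function.update (fun _ => Classical.arbitrary _) k j)
  exact ⟨q, by simpa using hq k⟩

/-- A diagram in `Ind_κ(C)` is the pointwise colimit of its stages. -/
theorem nonempty_isColimit_cocone : Nonempty (IsColimit (cocone ι)) :=
  ⟨evaluationJointlyReflectsColimits _ fun k =>
    have := final_idxFunctor hι hK r hr k
    (Functor.Final.isColimitWhiskerEquiv (idxFunctor ι k) (Cocone.mk (X.obj k) (ι k))).symm (hι k)⟩

end

end Stage

theorem comparison_essSurj {W : Type*} [Preorder W] [WellFoundedLT W]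
    (hK : HasCardinalLT (Arrow K) κ) (r : K → W)
    (hr : ∀ ⦃k k' : K⦄ (u : k ⟶ k'), r k < r k' ∨ ∃ h : k = k', u = eqToHom h) :
    (comparison κ C K).EssSurj where
  mem_essImage X := by
    choose J _ _ c ι hι using fun k => exists_directed_presentation κ (X.obj k)
    have hι (k : K) := (hι k).some
    have := Stage.isCardinalFiltered hι hK r hr
    have := hasColimit_comp_yon κ (Stage.diagram ι)
    -- The image of the formal colimit of the stages and `X` itself are colimits of the same
    -- diagram.
    exact ⟨_, ⟨(isColimitComparisonCocone
      (colimit.isColimit (Stage.diagram ι ⋙ yon κ (K ⥤ C)))).coconePointUniqueUpToIso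
        (Stage.nonempty_isColimit_cocone hι hK r hr).some⟩⟩

/-- The comparison functor is an equivalence for a `κ`-small category `K` whose nonidentity
morphisms strictly increase a well-founded rank. -/
theorem comparison_isEquivalence {W : Type*} [Preorder W] [WellFoundedLT W]
    (hK : HasCardinalLT (Arrow K) κ) (r : K → W)
    (hr : ∀ ⦃k k' : K⦄ (u : k ⟶ k'), r k < r k' ∨ ∃ h : k = k', u = eqToHom h) :
    (comparison κ C K).IsEquivalence where
  faithful := comparison_faithful hK
  full := comparison_full hK
  essSurj := comparison_essSurj hK r hr

end KappaInd

/-! ### Rank and size of `I^(α)` -/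

namespace OrdinalThickening

variable {I : Type w} [SmallCategory I] {α : Ordinal.{w}}

theorem lt_or_eq_eqToHom {k k' : OrdinalThickening I α} (u : k ⟶ k') :
    k.obj.2 < k'.obj.2 ∨ ∃ h : k = k', u = eqToHom h := by
  obtain ⟨k⟩ := k
  obtain ⟨k'⟩ := k'
  obtain ⟨u, hu | ⟨h, h'⟩⟩ := u
  · exact Or.inl hu
  · dsimp at h h'
    subst h h'
    exact Or.inr ⟨rfl, rfl⟩

/-- An arrow is determined by its component in `I` and the two ordinals at its ends, since `α` is a
poset. -/
theorem hasCardinalLT_arrow {κ : Cardinal.{w}} [Fact κ.IsRegular]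
    (hI : HasCardinalLT (Arrow I) κ) (hα : α < κ.ord) :
    HasCardinalLT (Arrow (OrdinalThickening I α)) κ := by
  have hκ : Cardinal.aleph0 ≤ κ := Cardinal.IsRegular.aleph0_le Fact.out
  have hα' : HasCardinalLT α.ToType κ := by
    rw [hasCardinalLT_iff_cardinal_mk_lt, Cardinal.mk_toType]
    exact Cardinal.lt_ord.1 hα
  refine (hasCardinalLT_prod hκ hI (hasCardinalLT_prod hκ hα' hα')).of_injective
    (fun f => (Arrow.mk f.hom.hom.1, f.left.obj.2, f.right.obj.2)) ?_
  rintro ⟨⟨⟨x, β⟩⟩, ⟨⟨y, γ⟩⟩, ⟨⟨f, f'⟩, hf⟩⟩ ⟨⟨⟨x', β'⟩⟩, ⟨⟨y', γ'⟩⟩, ⟨⟨g, g'⟩, hg⟩⟩ h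
  simp only [Prod.mk.injEq] at h
  obtain ⟨h, rfl, rfl⟩ := h
  cases h
  obtain rfl : f' = g' := Subsingleton.elim _ _
  rfl

end OrdinalThickening

theorem mainTheorem3 (κ : Cardinal.{w}) [Fact κ.IsRegular] (C : Type u) [Category.{w} C]
    (I : Type w) [SmallCategory I] (hI : HasCardinalLT (Arrow I) κ)
    (α : Ordinal.{w}) (hα : α < κ.ord) :
    (KappaInd.comparison κ C (OrdinalThickening I α)).IsEquivalence :=
  KappaInd.comparison_isEquivalence (OrdinalThickening.hasCardinalLT_arrow hI hα)
    (fun k => k.obj.2) fun _ _ u => OrdinalThickening.lt_or_eq_eqToHom u
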